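/- Let $n\geq 2$, let $\mathbb{S}^{n-1}\subset\mathbb{R}^n$ be the round unit sphere with its surface measure, and let $\kappa_m$ be the volume of the unit ball of $\mathbb{R}^m$ ($\kappa_0=1$). Let $H^1(\mathbb{S}^{n-1})$ be the space of real functions $h\in L^2(\mathbb{S}^{n-1})$ that have a weak gradient $\nabla h\in L^2$, and let $\overline{V_2}^n$ be the quadratic form on $H^1(\mathbb{S}^{n-1})$ given by $$\overline{V_2}^n(h)=c_n\left(\int_{\mathbb{S}^{n-1}}h^2-\frac{1}{n-1}\int_{\mathbb{S}^{n-1}}\|\nabla h\|^2\right),\qquad c_n=\frac{n-1}{2\kappa_{n-2}}.$$ Let $(\mathcal{B},N)$ be a direct orthonormal basis of $\mathbb{R}^{n+1}$ with last vector $N\in\mathbb{S}^n$, and let $R_{\mathcal{B},N}\in SO(n+1)$ be the rotation that sends the canonical basis of $\mathbb{R}^{n+1}$ to $(\mathcal{B},N)$. For $h\in H^1(\mathbb{S}^{n-1})$ define $E_{\mathcal{B},N}(h):\mathbb{S}^n\to\mathbb{R}$ by $E_{\mathcal{B},N}(h)(\pm N)=0$ and $$E_{\mathcal{B},N}(h)\bigl(R_{\mathcal{B},N}(\cos(t)\,x,\sin(t))\bigr)=\cos(t)\,h(x)\qquad\left(x\in\mathbb{S}^{n-1},\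 -\tfrac{\pi}{2}<t<\tfrac{\pi}{2}\right).$$ Then, for every $h\in H^1(\mathbb{S}^{n-1})$, the function $E_{\mathcal{B},N}(h)$ belongs to $H^1(\mathbb{S}^n)$ and $$\overline{V_2}^{n+1}(E_{\mathcal{B},N}(h))=\overline{V_2}^n(h).$$ -/

import Mathlib

open MeasureTheory
open scoped RealInnerProductSpace ContDiff

namespace IntrinsicArea

/-- The round unit sphere `S^{n-1}` of the Euclidean space `ℝⁿ`. -/
abbrev Sph (n : ℕ) : Type :=
  Metric.sphere (0 : EuclideanSpace ℝ (Fin n)) 1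

/-- The surface measure of `S^{n-1}`, of total mass `n κ_n`. -/
noncomputable def surf (n : ℕ) : Measure (Sph n) :=
  (volume : Measure (EuclideanSpace ℝ (Fin n))).toSphere

/-- A smooth vector field on `ℝⁿ` which is tangent to `S^{n-1}` along `S^{n-1}`. Its restriction to
the sphere is a smooth tangent field, and every smooth tangent field of the sphere is of this
form. -/
def IsTangentField {n : ℕ} (X : EuclideanSpace ℝ (Fin n) → EuclideanSpace ℝ (Fin n)) : Prop :=
  ContDiff ℝ ∞ X ∧ ∀ x : Sph n, ⟪X x, (x : EuclideanSpace ℝ (Fin n))⟫ = 0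

/-- The divergence on the sphere `S^{n-1}` of a field `X`: the trace of the derivative of `X` over
the tangent space at `x`, that is the full trace minus the contribution of the unit normal `x`. -/
noncomputable def sphDiv {n : ℕ} (X : EuclideanSpace ℝ (Fin n) → EuclideanSpace ℝ (Fin n))
    (x : Sph n) : ℝ :=
  LinearMap.trace ℝ (EuclideanSpace ℝ (Fin n)) (fderiv ℝ X x).toLinearMap
    - ⟪fderiv ℝ X x x, (x : EuclideanSpace ℝ (Fin n))⟫

/-- `G` is a square integrable weak gradient of `h` on `S^{n-1}`: it is tangent to the sphere
almost everywhere, and `∫ h div X = - ∫ ⟨G, X⟩` for every smooth tangent field `X`. -/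
def IsWeakGradient {n : ℕ} (h : Sph n → ℝ) (G : Sph n → EuclideanSpace ℝ (Fin n)) : Prop :=
  MemLp G 2 (surf n) ∧
    (∀ᵐ x ∂(surf n), ⟪G x, (x : EuclideanSpace ℝ (Fin n))⟫ = 0) ∧
    ∀ X : EuclideanSpace ℝ (Fin n) → EuclideanSpace ℝ (Fin n), IsTangentField X →
      ∫ x, h x * sphDiv X x ∂(surf n) = -∫ x, ⟪G x, X x⟫ ∂(surf n)

/-- The Sobolev space `H¹(S^{n-1})`: the square integrable functions with a square integrable weak
gradient. -/
def MemH1 {n : ℕ} (h : Sph n → ℝ) : Prop :=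
  MemLp h 2 (surf n) ∧ ∃ G, IsWeakGradient h G

open Classical in
/-- The weak gradient of `h` (a weak gradient is unique up to equality almost everywhere; the value
is `0` if there is none). -/
noncomputable def weakGrad {n : ℕ} (h : Sph n → ℝ) : Sph n → EuclideanSpace ℝ (Fin n) :=
  if H : ∃ G, IsWeakGradient h G then H.choose else 0

/-- The volume `κ_n` of the closed unit ball of `ℝⁿ`. -/
noncomputable def kappa (n : ℕ) : ℝ :=
  (volume (Metric.closedBall (0 : EuclideanSpace ℝ (Fin n)) 1)).toReal

/-- The constant `c_n = (n - 1) / (2 κ_{n-2})`, for `n ≥ 2`. -/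
noncomputable def cConst (n : ℕ) : ℝ :=
  ((n : ℝ) - 1) / (2 * kappa (n - 2))

/-- The form `V̄₂ⁿ(h) = c_n (‖h‖² - (n - 1)⁻¹ ‖∇h‖²)`, with the norms of `L²(S^{n-1})`. -/
noncomputable def V2bar (n : ℕ) (h : Sph n → ℝ) : ℝ :=
  cConst n * ((∫ x, h x ^ 2 ∂(surf n))
    - ((n : ℝ) - 1)⁻¹ * ∫ x, ‖weakGrad h x‖ ^ 2 ∂(surf n))

/-- An orthonormal basis `b = (𝓑, N)` of `ℝⁿ⁺¹`, with `N` its last vector, is direct if it has the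
orientation of the canonical basis. -/
def IsDirect {n : ℕ}
    (b : OrthonormalBasis (Fin (n + 1)) ℝ (EuclideanSpace ℝ (Fin (n + 1)))) : Prop :=
  b.toBasis.orientation = (EuclideanSpace.basisFun (Fin (n + 1)) ℝ).toBasis.orientation

/-- The vector `R(y, s)`, where `R` is the linear isometry which sends the canonical basis of
`ℝⁿ⁺¹` to `b`. -/
noncomputable def rot {n : ℕ}
    (b : OrthonormalBasis (Fin (n + 1)) ℝ (EuclideanSpace ℝ (Fin (n + 1))))
    (y : EuclideanSpace ℝ (Fin n)) (s : ℝ) : EuclideanSpace ℝ (Fin (n + 1)) :=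
  b.repr.symm (WithLp.toLp 2 (Fin.snoc (α := fun _ => ℝ) y.ofLp s))

/-- The component `y` of `v = R(y, s)`: the first `n` coordinates of `v` in the basis `b`. -/
noncomputable def hor {n : ℕ}
    (b : OrthonormalBasis (Fin (n + 1)) ℝ (EuclideanSpace ℝ (Fin (n + 1))))
    (v : EuclideanSpace ℝ (Fin (n + 1))) : EuclideanSpace ℝ (Fin n) :=
  WithLp.toLp 2 fun i => b.repr v i.castSucc

/-- The extension `E_{𝓑,N}(h)`. A point `v` of `Sⁿ` other than `N` and `-N` is `R(cos t x, sin t)`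
for exactly one `x ∈ S^{n-1}` and one `t ∈ ]-π/2, π/2[`. Then `hor b v = cos t x`, so that
`cos t = ‖hor b v‖`, and the value at `v` is `cos t h(x)`. The value at `N` and `-N` is `0`. -/
noncomputable def extend {n : ℕ}
    (b : OrthonormalBasis (Fin (n + 1)) ℝ (EuclideanSpace ℝ (Fin (n + 1))))
    (h : Sph n → ℝ) (v : Sph (n + 1)) : ℝ :=
  open Classical in
  if H : hor b v = 0 then 0
  else ‖hor b v‖ * h ⟨‖hor b v‖⁻¹ • hor b v, by simp [norm_smul, H]⟩

theorem hor_rot {n : ℕ}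
    (b : OrthonormalBasis (Fin (n + 1)) ℝ (EuclideanSpace ℝ (Fin (n + 1))))
    (y : EuclideanSpace ℝ (Fin n)) (s : ℝ) : hor b (rot b y s) = y := by
  ext i
  simp [hor, rot]

theorem norm_rot_sq {n : ℕ}
    (b : OrthonormalBasis (Fin (n + 1)) ℝ (EuclideanSpace ℝ (Fin (n + 1))))
    (y : EuclideanSpace ℝ (Fin n)) (s : ℝ) : ‖rot b y s‖ ^ 2 = ‖y‖ ^ 2 + s ^ 2 := by
  simp [rot, EuclideanSpace.norm_sq_eq, Fin.sum_univ_castSucc]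

theorem rot_hor {n : ℕ}
    (b : OrthonormalBasis (Fin (n + 1)) ℝ (EuclideanSpace ℝ (Fin (n + 1))))
    (v : EuclideanSpace ℝ (Fin (n + 1))) : rot b (hor b v) (b.repr v (Fin.last n)) = v := by
  rw [rot, LinearIsometryEquiv.symm_apply_eq]
  ext i
  refine Fin.lastCases ?_ (fun j => ?_) i <;> simp [hor]

/-- The coordinates `Φ_{𝓑,N}(x, t) = R(cos t x, sin t)` on `Sⁿ`. -/
noncomputable def Phi {n : ℕ}
    (b : OrthonormalBasis (Fin (n + 1)) ℝ (EuclideanSpace ℝ (Fin (n + 1))))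
    (x : Sph n) (t : ℝ) : Sph (n + 1) :=
  ⟨rot b (Real.cos t • (x : EuclideanSpace ℝ (Fin n))) (Real.sin t), by
    have hx : ‖(x : EuclideanSpace ℝ (Fin n))‖ = 1 := by simp
    have h := norm_rot_sq b (Real.cos t • (x : EuclideanSpace ℝ (Fin n))) (Real.sin t)
    rw [norm_smul, hx, mul_one, Real.norm_eq_abs, sq_abs, Real.cos_sq_add_sin_sq] at h
    have h0 := norm_nonneg (rot b (Real.cos t • (x : EuclideanSpace ℝ (Fin n))) (Real.sin t))
    rw [mem_sphere_zero_iff_norm]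
    nlinarith⟩

/-- `E(h)(Φ(x, t)) = cos t h(x)`. -/
theorem extend_Phi {n : ℕ}
    (b : OrthonormalBasis (Fin (n + 1)) ℝ (EuclideanSpace ℝ (Fin (n + 1))))
    (h : Sph n → ℝ) (x : Sph n) (t : ℝ) (ht : t ∈ Set.Ioo (-(Real.pi / 2)) (Real.pi / 2)) :
    extend b h (Phi b x t) = Real.cos t * h x := by
  have hc : 0 < Real.cos t := Real.cos_pos_of_mem_Ioo ht
  have hx : ‖(x : EuclideanSpace ℝ (Fin n))‖ = 1 := by simp
  have hx0 : (x : EuclideanSpace ℝ (Fin n)) ≠ 0 := by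
    intro h0
    simp [h0] at hx
  have e : hor b (Phi b x t) = Real.cos t • (x : EuclideanSpace ℝ (Fin n)) := hor_rot b _ _
  have en : ‖hor b (Phi b x t)‖ = Real.cos t := by
    rw [e, norm_smul, hx, mul_one, Real.norm_eq_abs, abs_of_pos hc]
  have hne : ¬ hor b (Phi b x t) = 0 := by
    rw [e]
    exact smul_ne_zero hc.ne' hx0
  unfold extend
  rw [dif_neg hne]
  congr 1
  · congr 1
    apply Subtype.ext
    simp only [en]
    rw [e, smul_smul, inv_mul_cancel₀ hc.ne', one_smul]

/-- `E(h)` vanishes at `N` and `-N`. -/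
theorem extend_pole {n : ℕ}
    (b : OrthonormalBasis (Fin (n + 1)) ℝ (EuclideanSpace ℝ (Fin (n + 1))))
    (h : Sph n → ℝ) (v : Sph (n + 1))
    (hv : (v : EuclideanSpace ℝ (Fin (n + 1))) = b (Fin.last n) ∨
      (v : EuclideanSpace ℝ (Fin (n + 1))) = -b (Fin.last n)) :
    extend b h v = 0 := by
  have : hor b v = 0 := by
    ext i
    rcases hv with hv | hv <;> simp [hor, hv, Fin.ext_iff, i.2.ne]
  simp [extend, this]

end IntrinsicArea

namespace IntrinsicArea
open scoped ENNReal

/-! In the coordinates `Phi b x t` the surface measure of Sⁿ is cosⁿ⁻¹ t dx dt, and E(h) = cos t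
h(x). The parallel of latitude t has radius cos t, so the factor cos t of E(h) cancels the 1/cos t
of the gradient along the parallel. The gradient of E(h) should therefore be `liftGrad`: G(x) along
the parallel and -sin t h(x) along the meridian. It is square integrable up to the poles.

That this is a weak gradient is tested on a tangent field X. Let Y be the tangential part of its
horizontal component on a parallel, and β its meridian component. Then `sphDiv_tang_horField` gives
cos t div X = div Y + (cos t ∂β/∂t - n sin t β) + sin t β. The weak gradient of h handles div Y for
each fixed t. The bracket times cosⁿ⁻¹ t is the t-derivative of cosⁿ t β, which vanishes at both
poles, so it integrates to 0 without any cutoff (`integral_slice_meridian`). What remains is the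
pairing of `liftGrad` with X (`isWeakGradient_liftGrad`).

Let W_k be the integral of cosᵏ over [-π/2, π/2], A = ∫h² and B = ∫‖G‖². Then ∫E(h)² = W_{n+1} A,
and the gradient term is W_{n-1} B + (W_{n-1} - W_{n+1}) A. With (n+1) W_{n+1} = n W_{n-1}, the form
of E(h) becomes c_{n+1} W_{n-1} ((n-1)/n) (A - B/(n-1)). The factor in front is c_n because κ_{n-1}
= W_{n-1} κ_{n-2} (`kappa_succ`). -/

/-- The Euclidean space `ℝⁿ`. -/
abbrev Euc (n : ℕ) : Type := EuclideanSpace ℝ (Fin n)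

/-! ### The surface measure of Sⁿ in the coordinates (x, t) -/

theorem continuous_rot {n : ℕ} (b : OrthonormalBasis (Fin (n + 1)) ℝ (Euc (n + 1))) :
    Continuous fun p : Euc n × ℝ => rot b p.1 p.2 := by
  unfold rot
  refine b.repr.symm.continuous.comp ((PiLp.continuous_toLp 2 _).comp ?_)
  refine continuous_pi fun i => ?_
  refine Fin.lastCases ?_ (fun j => ?_) i
  · simpa using continuous_snd
  · simp only [Fin.snoc_castSucc]
    fun_prop

theorem measurePreserving_rot {n : ℕ} (b : OrthonormalBasis (Fin (n + 1)) ℝ (Euc (n + 1))) :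
    MeasurePreserving (fun p : Euc n × ℝ => rot b p.1 p.2) (volume.prod volume) volume := by
  have h1 : MeasurePreserving (fun p : Euc n × ℝ => (p.2, p.1.ofLp)) (volume.prod volume)
      (volume.prod volume) :=
    ((MeasurePreserving.id volume).prod (PiLp.volume_preserving_ofLp (Fin n))).comp
      Measure.measurePreserving_swap
  have h2 := (volume_preserving_piFinSuccAbove (fun _ : Fin (n + 1) => ℝ) (Fin.last n)).symm
  have h3 := PiLp.volume_preserving_toLp (Fin (n + 1))
  have h4 := b.repr.symm.measurePreserving
  have h5 := h4.comp (h3.comp (h2.comp h1))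
  refine (funext fun p => ?_ : (fun p : Euc n × ℝ => rot b p.1 p.2) = _) ▸ h5
  simp [rot, MeasurableEquiv.piFinSuccAbove, Fin.insertNthEquiv, Fin.insertNth_last']

theorem lintegral_polar (m : ℕ) {f : Euc (m + 1) → ℝ≥0∞} (hf : Measurable f) :
    ∫⁻ y, f y = ∫⁻ x : Sph (m + 1), (∫⁻ r in Set.Ioi (0 : ℝ),
      ENNReal.ofReal (r ^ m) * f (r • (x : Euc (m + 1)))) ∂(surf (m + 1)) := by
  have hp := (volume : Measure (Euc (m + 1))).measurePreserving_homeomorphUnitSphereProd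
  have hd : Module.finrank ℝ (Euc (m + 1)) - 1 = m := by simp
  rw [hd] at hp
  calc ∫⁻ y, f y = ∫⁻ y in ({0}ᶜ : Set (Euc (m + 1))), f y := by
        rw [restrict_compl_singleton]
    _ = ∫⁻ y : ({0}ᶜ : Set (Euc (m + 1))), f y ∂(volume.comap Subtype.val) := by
        rw [lintegral_subtype_comap (measurableSet_singleton _).compl]
    _ = ∫⁻ p : Sph (m + 1) × Set.Ioi (0 : ℝ), f (p.2.1 • (p.1 : Euc (m + 1)))
          ∂((surf (m + 1)).prod (Measure.volumeIoiPow m)) := by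
        rw [surf, ← hp.lintegral_comp_emb (Homeomorph.measurableEmbedding _)]
        refine lintegral_congr fun y => ?_
        congr 1
        have hy : (y : Euc (m + 1)) ≠ 0 := y.2
        simp [smul_smul, hy]
    _ = _ := by
        rw [lintegral_prod _ (by fun_prop)]
        refine lintegral_congr fun x => ?_
        rw [Measure.volumeIoiPow, lintegral_withDensity_eq_lintegral_mul _ (by fun_prop)
          (by fun_prop)]
        simp only [Pi.mul_apply]
        rw [lintegral_subtype_comap measurableSet_Ioi
          (fun r : ℝ => ENNReal.ofReal (r ^ m) * f (r • (x : Euc (m + 1))))]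

/-- Polar coordinates of the plane, where the condition ρ > 0 reads cos t > 0. Here ρ plays the
distance to the axis of N and s the height, so that t becomes the latitude. -/
theorem lintegral_halfPlane {F : ℝ × ℝ → ℝ≥0∞} (hF : Measurable F) :
    ∫⁻ ρ in Set.Ioi (0 : ℝ), ∫⁻ s, F (ρ, s) =
      ∫⁻ r in Set.Ioi (0 : ℝ), ∫⁻ t in Set.Ioo (-(Real.pi / 2)) (Real.pi / 2),
        ENNReal.ofReal r * F (r * Real.cos t, r * Real.sin t) := by
  set H : Set (ℝ × ℝ) := Set.Ioi 0 ×ˢ Set.univ with hH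
  have hHm : MeasurableSet H := measurableSet_Ioi.prod MeasurableSet.univ
  have e1 : ∫⁻ ρ in Set.Ioi (0 : ℝ), ∫⁻ s, F (ρ, s) = ∫⁻ p, H.indicator F p := by
    rw [lintegral_indicator hHm, hH, Measure.volume_eq_prod, ← Measure.prod_restrict,
      Measure.restrict_univ, lintegral_prod _ hF.aemeasurable]
  have hI : Measurable fun p : ℝ × ℝ => ENNReal.ofReal p.1 * F (p.1 * Real.cos p.2,
      p.1 * Real.sin p.2) := by
    fun_prop
  rw [e1, ← lintegral_comp_polarCoord_symm]
  have e2 : ∀ p ∈ polarCoord.target, ENNReal.ofReal p.1 • H.indicator F (polarCoord.symm p) =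
      (Set.univ ×ˢ Set.Ioo (-(Real.pi / 2)) (Real.pi / 2)).indicator
        (fun p : ℝ × ℝ => ENNReal.ofReal p.1 * F (p.1 * Real.cos p.2, p.1 * Real.sin p.2)) p := by
    rintro ⟨r, t⟩ ⟨hr, ht1, ht2⟩
    have hr : 0 < r := hr
    have ht1 : -Real.pi < t := ht1
    have ht2 : t < Real.pi := ht2
    by_cases ht : t ∈ Set.Ioo (-(Real.pi / 2)) (Real.pi / 2)
    · have hc := Real.cos_pos_of_mem_Ioo ht
      have hm : polarCoord.symm (r, t) ∈ H := by simp [hH, hr, hc]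
      rw [Set.indicator_of_mem hm, Set.indicator_of_mem (by simpa using ht)]
      simp
    · have hc : Real.cos t ≤ 0 := by
        by_cases h0 : t ≤ 0
        · rw [← Real.cos_neg]
          refine Real.cos_nonpos_of_pi_div_two_le_of_le ?_ (by linarith [Real.pi_pos])
          by_contra hlt
          exact ht ⟨by linarith, by linarith [Real.pi_pos]⟩
        · refine Real.cos_nonpos_of_pi_div_two_le_of_le ?_ (by linarith [Real.pi_pos])
          by_contra hlt
          exact ht ⟨by linarith [Real.pi_pos], by linarith⟩
      have hm : polarCoord.symm (r, t) ∉ H := by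
        simpa [hH] using mul_nonpos_of_nonneg_of_nonpos hr.le hc
      rw [Set.indicator_of_notMem hm, Set.indicator_of_notMem (by simpa using ht)]
      simp
  rw [setLIntegral_congr_fun polarCoord.open_target.measurableSet e2,
    setLIntegral_indicator (MeasurableSet.univ.prod measurableSet_Ioo)]
  have e3 : Set.univ ×ˢ Set.Ioo (-(Real.pi / 2)) (Real.pi / 2) ∩ polarCoord.target =
      Set.Ioi (0 : ℝ) ×ˢ Set.Ioo (-(Real.pi / 2)) (Real.pi / 2) := by
    ext ⟨r, t⟩
    simp only [polarCoord_target, Set.mem_inter_iff, Set.mem_prod, Set.mem_univ, true_and,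
      Set.mem_Ioo, Set.mem_Ioi]
    have := Real.pi_pos
    constructor
    · rintro ⟨h1, h2, -⟩
      exact ⟨h2, h1⟩
    · rintro ⟨h1, h2, h3⟩
      exact ⟨⟨h2, h3⟩, h1, by linarith, by linarith⟩
  rw [e3, Measure.volume_eq_prod, ← Measure.prod_restrict, lintegral_prod _ hI.aemeasurable]

open Classical in
/-- The direction `v / ‖v‖` of a vector `v` of `ℝᵐ⁺¹` (a fixed unit vector if `v = 0`). -/
noncomputable def dir {m : ℕ} (v : Euc (m + 1)) : Sph (m + 1) :=
  ⟨if v = 0 then EuclideanSpace.single 0 1 else ‖v‖⁻¹ • v, by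
    split_ifs with hv
    · simp
    · simp [norm_smul, hv]⟩

theorem measurable_dir {m : ℕ} : Measurable (dir (m := m)) := by
  refine Measurable.subtype_mk (Measurable.ite (measurableSet_singleton _) (by fun_prop) ?_)
  fun_prop

theorem dir_smul {m : ℕ} {r : ℝ} (hr : 0 < r) (x : Sph (m + 1)) :
    dir (r • (x : Euc (m + 1))) = x := by
  have hx : ‖(x : Euc (m + 1))‖ = 1 := by simp
  have hx0 : (x : Euc (m + 1)) ≠ 0 := by
    intro h0
    simp [h0] at hx
  apply Subtype.ext
  simp [dir, hr.ne', hx0, norm_smul, abs_of_pos hr, smul_smul]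

theorem norm_smul_dir {m : ℕ} (v : Euc (m + 1)) : ‖v‖ • (dir v : Euc (m + 1)) = v := by
  by_cases hv : v = 0
  · simp [hv]
  · simp [dir, hv, smul_smul]

theorem rot_smul {n : ℕ} (b : OrthonormalBasis (Fin (n + 1)) ℝ (Euc (n + 1))) (r : ℝ)
    (y : Euc n) (s : ℝ) : rot b (r • y) (r * s) = r • rot b y s := by
  unfold rot
  rw [← map_smul]
  congr 1
  ext i
  refine Fin.lastCases ?_ (fun j => ?_) i <;> simp

theorem continuous_Phi {n : ℕ} (b : OrthonormalBasis (Fin (n + 1)) ℝ (Euc (n + 1))) :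
    Continuous fun p : Sph n × ℝ => Phi b p.1 p.2 := by
  refine Continuous.subtype_mk ?_ _
  exact (continuous_rot b).comp (f := fun p : Sph n × ℝ =>
    (Real.cos p.2 • (p.1 : Euc n), Real.sin p.2)) (by fun_prop)

instance (n : ℕ) : IsFiniteMeasure (surf n) := by
  unfold surf
  infer_instance

/-- The measure `cosᵐ t dt` on `]-π/2, π/2[`. -/
noncomputable def slice (m : ℕ) : Measure ℝ :=
  (volume.restrict (Set.Ioo (-(Real.pi / 2)) (Real.pi / 2))).withDensity
    fun t => ENNReal.ofReal (Real.cos t ^ m)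

instance (m : ℕ) : IsFiniteMeasure (slice m) := by
  refine isFiniteMeasure_withDensity (ne_top_of_le_ne_top
    (b := ∫⁻ t in Set.Ioo (-(Real.pi / 2)) (Real.pi / 2), 1) (by simp) ?_)
  refine setLIntegral_mono measurable_const fun t ht => ?_
  simpa using pow_le_one₀ (Real.cos_pos_of_mem_Ioo ht).le (Real.cos_le_one t)

/-- The function 1_{‖v‖<1} g(v/‖v‖) is integrated in two ways: in polar coordinates of the whole
space, and by splitting off the last coordinate, with polar coordinates first in the horizontal
space and then in the half-plane (ρ, s). Both give the same radial constant c times one of the two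
sides, and 0 < c < ∞ allows cancellation. -/
theorem lintegral_surf_succ {m : ℕ}
    (b : OrthonormalBasis (Fin (m + 1 + 1)) ℝ (Euc (m + 1 + 1))) {g : Sph (m + 1 + 1) → ℝ≥0∞}
    (hg : Measurable g) :
    ∫⁻ u, g u ∂(surf (m + 1 + 1)) =
      ∫⁻ x, (∫⁻ t, g (Phi b x t) ∂(slice m)) ∂(surf (m + 1)) := by
  set k : ℝ → ℝ≥0∞ := (Set.Iio (1 : ℝ)).indicator 1 with hk
  have hkm : Measurable k := measurable_const.indicator measurableSet_Iio
  set f : Euc (m + 1 + 1) → ℝ≥0∞ := fun v => k ‖v‖ * g (dir v) with hf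
  have hfm : Measurable f := (hkm.comp measurable_norm).mul (hg.comp measurable_dir)
  set c : ℝ≥0∞ := ∫⁻ r in Set.Ioi (0 : ℝ), ENNReal.ofReal (r ^ (m + 1)) * k r with hc
  have hc' : c = ∫⁻ r in Set.Ioo (0 : ℝ) 1, ENNReal.ofReal (r ^ (m + 1)) := by
    have : ∀ r, ENNReal.ofReal (r ^ (m + 1)) * k r =
        (Set.Iio (1 : ℝ)).indicator (fun r => ENNReal.ofReal (r ^ (m + 1))) r := by
      intro r
      by_cases hr : r ∈ Set.Iio (1 : ℝ)
      · simp [hk, Set.indicator_of_mem hr]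
      · simp [hk, Set.indicator_of_notMem hr]
    simp_rw [hc, this]
    rw [setLIntegral_indicator measurableSet_Iio, Set.inter_comm, Set.Ioi_inter_Iio]
  have hc0 : c ≠ 0 := by
    rw [hc']
    refine ((setLIntegral_pos_iff (by fun_prop)).2 ?_).ne'
    have : Set.Ioo (0 : ℝ) 1 ⊆
        (Function.support fun r : ℝ => ENNReal.ofReal (r ^ (m + 1))) ∩ Set.Ioo 0 1 := by
      intro r hr
      refine ⟨?_, hr⟩
      simpa using pow_pos hr.1 _
    exact lt_of_lt_of_le (by simp) (measure_mono this)
  have hct : c ≠ ⊤ := by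
    rw [hc']
    refine ne_top_of_le_ne_top (b := ∫⁻ r in Set.Ioo (0 : ℝ) 1, 1) (by simp) ?_
    refine setLIntegral_mono measurable_const fun r hr => ?_
    simpa using pow_le_one₀ hr.1.le hr.2.le
  have e1 : ∫⁻ v, f v = c * ∫⁻ u, g u ∂(surf (m + 1 + 1)) := by
    rw [lintegral_polar (m + 1) hfm, ← lintegral_const_mul _ hg]
    refine lintegral_congr fun u => ?_
    rw [hc, ← lintegral_mul_const _ (by fun_prop)]
    refine setLIntegral_congr_fun measurableSet_Ioi fun r hr => ?_
    have hr : 0 < r := hr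
    simp only [hf]
    rw [dir_smul hr, norm_smul, mul_assoc]
    simp [abs_of_pos hr]
  have e2 : ∫⁻ v, f v = c * ∫⁻ x, (∫⁻ t, g (Phi b x t) ∂(slice m)) ∂(surf (m + 1)) := by
    have hΦ := continuous_Phi b
    have hgΦ : Measurable fun p : Sph (m + 1) × ℝ => g (Phi b p.1 p.2) := hg.comp hΦ.measurable
    have hfr : Measurable fun p : Euc (m + 1) × ℝ => f (rot b p.1 p.2) :=
      hfm.comp (continuous_rot b).measurable
    rw [← (measurePreserving_rot b).lintegral_comp hfm, lintegral_prod _ hfr.aemeasurable,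
      lintegral_polar m hfr.lintegral_prod_right', ← lintegral_const_mul _ hgΦ.lintegral_prod_right']
    refine lintegral_congr fun x => ?_
    have hF : Measurable fun p : ℝ × ℝ =>
        ENNReal.ofReal (p.1 ^ m) * f (rot b (p.1 • (x : Euc (m + 1))) p.2) :=
      (by fun_prop : Measurable fun p : ℝ × ℝ => ENNReal.ofReal (p.1 ^ m)).mul
        (hfr.comp (f := fun p : ℝ × ℝ => (p.1 • (x : Euc (m + 1)), p.2)) (by fun_prop))
    have hgx : Measurable fun t => g (Phi b x t) :=
      hgΦ.comp (f := fun t : ℝ => (x, t)) (by fun_prop)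
    have e3 := lintegral_halfPlane hF
    calc _ = ∫⁻ ρ in Set.Ioi (0 : ℝ), ∫⁻ s, ENNReal.ofReal (ρ ^ m) *
          f (rot b (ρ • (x : Euc (m + 1))) s) := by
          refine setLIntegral_congr_fun measurableSet_Ioi fun r hr => ?_
          simp only
          exact (lintegral_const_mul _ (hfr.comp (f := fun s : ℝ => (r • (x : Euc (m + 1)), s))
            (by fun_prop))).symm
      _ = _ := e3
      _ = ∫⁻ r in Set.Ioi (0 : ℝ), (ENNReal.ofReal (r ^ (m + 1)) * k r) *
            ∫⁻ t, g (Phi b x t) ∂(slice m) := by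
          refine setLIntegral_congr_fun measurableSet_Ioi fun r hr => ?_
          have hr : 0 < r := hr
          simp only [slice]
          rw [lintegral_withDensity_eq_lintegral_mul _ (by fun_prop) hgx,
            ← lintegral_const_mul _ (by fun_prop)]
          -- The Jacobian r of the half-plane and the weight ρᵐ = (r cos t)ᵐ combine into rᵐ⁺¹ cosᵐ
          -- t, which separates the radius from the latitude.
          refine setLIntegral_congr_fun measurableSet_Ioo fun t ht => ?_
          have hct := Real.cos_pos_of_mem_Ioo ht
          have e4 : rot b ((r * Real.cos t) • (x : Euc (m + 1))) (r * Real.sin t) =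
              r • (Phi b x t : Euc (m + 1 + 1)) := by
            rw [mul_smul, rot_smul]
            rfl
          simp only [e4, hf, Pi.mul_apply]
          rw [dir_smul hr, norm_smul, mul_pow, pow_succ, ENNReal.ofReal_mul (by positivity),
            ENNReal.ofReal_mul (by positivity)]
          simp only [Real.norm_eq_abs, abs_of_pos hr, norm_eq_of_mem_sphere, mul_one]
          ring
      _ = _ := by rw [lintegral_mul_const _ (by fun_prop)]
  exact (ENNReal.mul_right_inj hc0 hct).1 (e1.symm.trans e2)

theorem measurePreserving_Phi {m : ℕ}
    (b : OrthonormalBasis (Fin (m + 1 + 1)) ℝ (Euc (m + 1 + 1))) :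
    MeasurePreserving (fun p : Sph (m + 1) × ℝ => Phi b p.1 p.2)
      ((surf (m + 1)).prod (slice m)) (surf (m + 1 + 1)) := by
  have hΦ := (continuous_Phi b).measurable
  refine ⟨hΦ, Measure.ext_of_lintegral _ fun g hg => ?_⟩
  have h2 : Measurable fun p : Sph (m + 1) × ℝ => g (Phi b p.1 p.2) := hg.comp hΦ
  rw [lintegral_map hg hΦ, lintegral_prod _ h2.aemeasurable, lintegral_surf_succ b hg]

/-! ### Uniqueness of the weak gradient -/

/-- The tangential part `A y - ⟪A y, y⟫ y` of a field `A`. -/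
noncomputable def tang {n : ℕ} (A : Euc n → Euc n) (y : Euc n) : Euc n :=
  A y - ⟪A y, y⟫ • y

theorem isTangentField_tang {n : ℕ} {A : Euc n → Euc n} (hA : ContDiff ℝ ∞ A) :
    IsTangentField (tang A) := by
  refine ⟨hA.sub ((hA.inner ℝ contDiff_id).smul contDiff_id), fun x => ?_⟩
  simp [tang, inner_sub_left, inner_smul_left]

theorem inner_tang {n : ℕ} (A : Euc n → Euc n) {v y : Euc n} (hv : ⟪v, y⟫ = 0) :
    ⟪v, tang A y⟫ = ⟪v, A y⟫ := by
  simp [tang, inner_sub_right, inner_smul_right, hv]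

/-- The tangential parts of the fields g w, with g a smooth bump and w a constant vector, are enough
test fields: paired with a tangent vector they give the same as g w. The difference of two weak
gradients is thus orthogonal to every g w, and the fundamental lemma of the calculus of variations
applies. -/
theorem IsWeakGradient.ae_eq {n : ℕ} {h : Sph n → ℝ} {G G' : Sph n → Euc n}
    (hG : IsWeakGradient h G) (hG' : IsWeakGradient h G') : G =ᵐ[surf n] G' := by
  obtain ⟨hG1, hG2, hG3⟩ := hG
  obtain ⟨hG1', hG2', hG3'⟩ := hG'
  have hem : MeasurableEmbedding (Subtype.val : Sph n → Euc n) :=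
    MeasurableEmbedding.subtype_coe Metric.isClosed_sphere.measurableSet
  have hi := hG1.integrable (by norm_num)
  have hi' := hG1'.integrable (by norm_num)
  set D : Sph n → Euc n := fun x => G x - G' x with hD
  have hDi : Integrable D (surf n) := hi.sub hi'
  -- Extension by zero moves the problem to ℝⁿ with the pushed-forward surface measure, where smooth
  -- compactly supported test functions are available.
  set f : Euc n → Euc n := Function.extend Subtype.val D 0 with hf
  have hfD : ∀ x : Sph n, f x = D x := fun x => Subtype.val_injective.extend_apply D 0 x
  have hfi : Integrable f ((surf n).map Subtype.val) := by
    rw [hem.integrable_map_iff]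
    exact hDi.congr (Filter.Eventually.of_forall fun x => (hfD x).symm)
  have key := ae_eq_zero_of_integral_contDiff_smul_eq_zero hfi.locallyIntegrable
    fun g hg hgc => by
      rw [hem.integral_map]
      simp_rw [hfD]
      have hgD : Integrable (fun x : Sph n => g x • D x) (surf n) := by
        obtain ⟨C, hC⟩ := hgc.exists_bound_of_continuous hg.continuous
        exact hDi.bdd_smul C (hg.continuous.comp continuous_subtype_val).aestronglyMeasurable
          (Filter.Eventually.of_forall fun x => hC x)
      refine ext_inner_right ℝ fun w => ?_
      rw [inner_zero_left, real_inner_comm, ← integral_inner hgD]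
      have hA : ContDiff ℝ ∞ fun y => g y • w := hg.smul contDiff_const
      have ht := isTangentField_tang hA
      have e := (hG3 _ ht).symm.trans (hG3' _ ht)
      rw [neg_inj] at e
      obtain ⟨C, hC⟩ := hgc.exists_bound_of_continuous hg.continuous
      have hin : ∀ {K : Sph n → Euc n}, Integrable K (surf n) →
          Integrable (fun x : Sph n => g x * ⟪K x, w⟫) (surf n) := fun hK =>
        (hK.inner_const w).bdd_mul (hg.continuous.comp continuous_subtype_val).aestronglyMeasurable
          (Filter.Eventually.of_forall fun x => hC x)
      have e1 : ∀ {K : Sph n → Euc n}, (∀ᵐ x ∂(surf n), ⟪K x, (x : Euc n)⟫ = 0) →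
          ∫ x, ⟪K x, tang (fun y => g y • w) x⟫ ∂(surf n) = ∫ x, g x * ⟪K x, w⟫ ∂(surf n) := by
        intro K hK
        refine integral_congr_ae (hK.mono fun x hx => ?_)
        simp only [inner_tang _ hx, inner_smul_right]
      rw [e1 hG2, e1 hG2'] at e
      calc ∫ x : Sph n, ⟪w, g x • D x⟫ ∂(surf n)
          = ∫ x : Sph n, (g x * ⟪G x, w⟫ - g x * ⟪G' x, w⟫) ∂(surf n) := by
            refine integral_congr_ae (Filter.Eventually.of_forall fun x => ?_)
            simp only [hD, inner_smul_right, inner_sub_right, real_inner_comm w]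
            ring
        _ = 0 := by rw [integral_sub (hin hi) (hin hi'), e, sub_self]
  rw [hem.ae_map_iff] at key
  refine key.mono fun x hx => ?_
  rw [hfD] at hx
  exact sub_eq_zero.1 hx

theorem integral_norm_weakGrad_sq {n : ℕ} {h : Sph n → ℝ} {G : Sph n → Euc n}
    (hG : IsWeakGradient h G) :
    ∫ x, ‖weakGrad h x‖ ^ 2 ∂(surf n) = ∫ x, ‖G x‖ ^ 2 ∂(surf n) := by
  have H : ∃ G, IsWeakGradient h G := ⟨G, hG⟩
  have hw : IsWeakGradient h (weakGrad h) := by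
    rw [weakGrad, dif_pos H]
    exact H.choose_spec
  refine integral_congr_ae ((hw.ae_eq hG).mono fun x hx => ?_)
  simp only [hx]

/-! ### The frame of parallels and meridians -/

section LinearAlgebra

variable {n : ℕ} (b : OrthonormalBasis (Fin (n + 1)) ℝ (Euc (n + 1)))

theorem inner_rot (y : Euc n) (s : ℝ) (v : Euc (n + 1)) :
    ⟪rot b y s, v⟫ = ⟪y, hor b v⟫ + s * ⟪b (Fin.last n), v⟫ := by
  rw [rot, ← b.repr.inner_map_map, LinearIsometryEquiv.apply_symm_apply]
  simp [PiLp.inner_apply, Fin.sum_univ_castSucc, hor, OrthonormalBasis.repr_apply_apply, mul_comm]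

/-- The horizontal component as a continuous linear map. -/
noncomputable def horL : Euc (n + 1) →L[ℝ] Euc n :=
  LinearMap.toContinuousLinearMap
    { toFun := hor b
      map_add' := fun v w => by ext i; simp [hor]
      map_smul' := fun c v => by ext i; simp [hor] }

@[simp] theorem horL_apply (v : Euc (n + 1)) : horL b v = hor b v := rfl

/-- The isometric inclusion `y ↦ R(y, 0)`. -/
noncomputable def incl : Euc n →L[ℝ] Euc (n + 1) :=
  LinearMap.toContinuousLinearMap
    { toFun := fun y => rot b y 0
      map_add' := fun v w => by
        refine ext_inner_right ℝ fun u => ?_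
        simp [inner_rot, inner_add_left]
      map_smul' := fun c v => by
        refine ext_inner_right ℝ fun u => ?_
        simp [inner_rot, inner_smul_left] }

theorem inner_incl (y : Euc n) (v : Euc (n + 1)) : ⟪incl b y, v⟫ = ⟪y, hor b v⟫ := by
  have h := inner_rot b y 0 v
  rw [zero_mul, add_zero] at h
  exact h

theorem rot_eq (y : Euc n) (s : ℝ) : rot b y s = incl b y + s • b (Fin.last n) := by
  refine ext_inner_right ℝ fun u => ?_
  simp [inner_rot, inner_add_left, inner_incl, inner_smul_left]

theorem hor_last : hor b (b (Fin.last n)) = 0 := by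
  ext i
  simp [hor, Fin.ext_iff, i.2.ne]

theorem incl_single (i : Fin n) : incl b (EuclideanSpace.single i 1) = b i.castSucc := by
  refine ext_inner_right ℝ fun u => ?_
  simp [inner_incl, hor, EuclideanSpace.inner_single_left, OrthonormalBasis.repr_apply_apply]

/-- `incl b` sends the standard basis to the first n vectors of b and is adjoint to `horL b`, so the
two traces share their first n diagonal entries. -/
theorem trace_eq_trace_hor (T : Euc (n + 1) →L[ℝ] Euc (n + 1)) :
    LinearMap.trace ℝ (Euc (n + 1)) T.toLinearMap =
      LinearMap.trace ℝ (Euc n) ((horL b).comp (T.comp (incl b))).toLinearMap +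
        ⟪T (b (Fin.last n)), b (Fin.last n)⟫ := by
  rw [LinearMap.trace_eq_sum_inner _ b,
    LinearMap.trace_eq_sum_inner _ (EuclideanSpace.basisFun (Fin n) ℝ), Fin.sum_univ_castSucc]
  congr 1
  · refine Finset.sum_congr rfl fun i _ => ?_
    simp [← inner_incl, incl_single]
  · simp [real_inner_comm]

/-- The unit vector `R(-sin t x, cos t)`, tangent to the meridian at `R(cos t x, sin t)`. -/
noncomputable def tau (x : Euc n) (t : ℝ) : Euc (n + 1) :=
  rot b (-Real.sin t • x) (Real.cos t)

theorem coe_Phi (x : Sph n) (t : ℝ) : (Phi b x t : Euc (n + 1)) =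
    Real.cos t • incl b x + Real.sin t • b (Fin.last n) := by
  simp [Phi, rot_eq]

theorem tau_eq (x : Euc n) (t : ℝ) : tau b x t =
    -Real.sin t • incl b x + Real.cos t • b (Fin.last n) := by
  simp [tau, rot_eq]

theorem incl_eq (x : Sph n) (t : ℝ) : incl b x =
    Real.cos t • (Phi b x t : Euc (n + 1)) - Real.sin t • tau b x t := by
  have h := Real.sin_sq_add_cos_sq t
  rw [coe_Phi, tau_eq]
  match_scalars
  · linear_combination -h
  · ring

theorem norm_tau (x : Sph n) (t : ℝ) : ‖tau b x t‖ = 1 := by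
  have h := norm_rot_sq b (-Real.sin t • (x : Euc n)) (Real.cos t)
  rw [norm_smul, norm_eq_of_mem_sphere, mul_one, norm_neg, Real.norm_eq_abs, sq_abs,
    Real.sin_sq_add_cos_sq] at h
  exact (pow_eq_one_iff_of_nonneg (norm_nonneg _) two_ne_zero).1 h

theorem hasDerivAt_Phi (x : Sph n) (t : ℝ) :
    HasDerivAt (fun t => (Phi b x t : Euc (n + 1))) (tau b x t) t := by
  simp only [coe_Phi, tau_eq]
  exact ((Real.hasDerivAt_cos t).smul_const _).add ((Real.hasDerivAt_sin t).smul_const _)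

theorem hasDerivAt_tau (x : Sph n) (t : ℝ) :
    HasDerivAt (fun t => tau b (x : Euc n) t) (-(Phi b x t : Euc (n + 1))) t := by
  simp only [coe_Phi, tau_eq]
  exact (((Real.hasDerivAt_sin t).neg.smul_const (incl b (x : Euc n))).add
    ((Real.hasDerivAt_cos t).smul_const (b (Fin.last n)))).congr_deriv (by module)

end LinearAlgebra

/-! ### The divergence on parallels and meridians -/

theorem sphDiv_tang {n : ℕ} {A : Euc n → Euc n} (hA : ContDiff ℝ ∞ A) (x : Sph n) :
    sphDiv (tang A) x = LinearMap.trace ℝ (Euc n) (fderiv ℝ A x).toLinearMap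
      - ⟪fderiv ℝ A x x, (x : Euc n)⟫ - (n - 1) * ⟪A x, (x : Euc n)⟫ := by
  have hx : ‖(x : Euc n)‖ = 1 := by simp
  set T := fderiv ℝ A x with hT
  have hd : HasFDerivAt A T x := (hA.differentiable (by simp) _).hasFDerivAt
  have hd2 := hd.sub ((hd.inner ℝ (hasFDerivAt_id (x : Euc n))).smul (hasFDerivAt_id (x : Euc n)))
  have e : fderiv ℝ (tang A) x = _ := hd2.fderiv
  set c := ⟪A x, (x : Euc n)⟫ with hc
  set L : Euc n →ₗ[ℝ] ℝ := (innerSL ℝ (A x)).toLinearMap +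
    (innerSL ℝ (x : Euc n)).toLinearMap.comp T.toLinearMap with hL
  -- The rank-one term has trace L x, which its normal contribution cancels. The term c • id has
  -- trace n c, of which the normal direction takes back one c: this is the factor n - 1.
  have e2 : (fderiv ℝ (tang A) x).toLinearMap =
      T.toLinearMap - L.smulRight (x : Euc n) - c • LinearMap.id := by
    rw [e]
    ext1 v
    simp [hL, hc, real_inner_comm (x : Euc n), sub_sub, add_comm]
  have e3 : fderiv ℝ (tang A) x x = T x - L x • (x : Euc n) - c • (x : Euc n) :=
    LinearMap.congr_fun e2 (x : Euc n)
  have e4 : L x = c + ⟪T x, (x : Euc n)⟫ := by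
    simp [hL, hc, real_inner_comm (x : Euc n)]
  rw [sphDiv, e2, e3, map_sub, map_sub, map_smul, LinearMap.trace_smulRight, LinearMap.trace_id]
  simp only [inner_sub_left, inner_smul_left, e4, real_inner_self_eq_norm_sq, hx]
  simp
  ring

section Divergence

variable {n : ℕ} (b : OrthonormalBasis (Fin (n + 1)) ℝ (Euc (n + 1)))

/-- The horizontal component of the field `X` on the parallel of latitude `t`, as a field of
`ℝⁿ`. -/
noncomputable def horField (X : Euc (n + 1) → Euc (n + 1)) (t : ℝ) (y : Euc n) : Euc n :=
  hor b (X (rot b (Real.cos t • y) (Real.sin t)))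

theorem horField_eq (X : Euc (n + 1) → Euc (n + 1)) (t : ℝ) :
    horField b X t = fun y => horL b (X (Real.cos t • incl b y + Real.sin t • b (Fin.last n))) := by
  funext y
  simp [horField, rot_eq]

theorem contDiff_horField {X : Euc (n + 1) → Euc (n + 1)} (hX : ContDiff ℝ ∞ X) (t : ℝ) :
    ContDiff ℝ ∞ (horField b X t) := by
  rw [horField_eq]
  exact (horL b).contDiff.comp (hX.comp (((incl b).contDiff.const_smul _).add contDiff_const))

theorem fderiv_horField {X : Euc (n + 1) → Euc (n + 1)} (hX : ContDiff ℝ ∞ X) (t : ℝ)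
    (x : Sph n) : fderiv ℝ (horField b X t) x =
      Real.cos t • (horL b).comp ((fderiv ℝ X (Phi b x t)).comp (incl b)) := by
  have h1 : HasFDerivAt X (fderiv ℝ X (Phi b x t))
      (Real.cos t • incl b x + Real.sin t • b (Fin.last n)) := by
    rw [← coe_Phi]
    exact (hX.differentiable (by simp) _).hasFDerivAt
  have h2 : HasFDerivAt (fun y => Real.cos t • incl b y + Real.sin t • b (Fin.last n))
      (Real.cos t • incl b) (x : Euc n) :=
    ((incl b).hasFDerivAt.const_smul (Real.cos t)).add_const _
  have h3 := (horL b).hasFDerivAt.comp (x : Euc n) (h1.comp (x : Euc n) h2)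
  rw [horField_eq]
  refine h3.fderiv.trans ?_
  ext1 v
  simp

/-- The meridian component of a field `X`. -/
noncomputable def merid (X : Euc (n + 1) → Euc (n + 1)) (x : Sph n) (t : ℝ) : ℝ :=
  ⟪X (Phi b x t), tau b x t⟫

/-- The derivative of the meridian component of a field `X` along the meridian. -/
noncomputable def meridDeriv (X : Euc (n + 1) → Euc (n + 1)) (x : Sph n) (t : ℝ) : ℝ :=
  ⟪fderiv ℝ X (Phi b x t) (tau b x t), tau b x t⟫

/-- The derivative of `tau` is minus the position vector, to which X is orthogonal, so only the
derivative of X contributes. -/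
theorem hasDerivAt_merid {X : Euc (n + 1) → Euc (n + 1)} (hX : IsTangentField X) (x : Sph n)
    (t : ℝ) : HasDerivAt (merid b X x) (meridDeriv b X x t) t := by
  have h1 := ((hX.1.differentiable (by simp) (Phi b x t)).hasFDerivAt.comp_hasDerivAt t
    (hasDerivAt_Phi b x t)).inner ℝ (hasDerivAt_tau b x t)
  refine h1.congr_deriv ?_
  simp [meridDeriv, inner_neg_right, hX.2]

/-- The chain rule on a parallel of radius cos t gives the factor cos t. Removing the normal part of
the horizontal field costs n - 1 times its normal component, and this component is -sin t times the
meridian component, because X is orthogonal to the position vector. -/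
theorem sphDiv_tang_horField {X : Euc (n + 1) → Euc (n + 1)} (hX : IsTangentField X)
    (x : Sph n) (t : ℝ) :
    sphDiv (tang (horField b X t)) x =
      Real.cos t * (sphDiv X (Phi b x t) - meridDeriv b X x t) +
        (n - 1) * (Real.sin t * merid b X x t) := by
  set T := fderiv ℝ X (Phi b x t) with hT
  have hα : ⟪horField b X t x, (x : Euc n)⟫ = -(Real.sin t * merid b X x t) := by
    have h0 : horField b X t x = hor b (X (Phi b x t)) := rfl
    rw [h0, real_inner_comm, ← inner_incl, incl_eq b x t, inner_sub_left, inner_smul_left,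
      inner_smul_left, real_inner_comm, hX.2, merid, real_inner_comm]
    simp
  -- The position vector and `tau` form an orthonormal basis of the plane spanned by x and N, and
  -- the trace over that plane does not depend on the basis.
  have hr : ⟪T (Phi b x t), (Phi b x t : Euc (n + 1))⟫ + ⟪T (tau b x t), tau b x t⟫ =
      ⟪T (incl b x), incl b x⟫ + ⟪T (b (Fin.last n)), b (Fin.last n)⟫ := by
    have h := Real.sin_sq_add_cos_sq t
    rw [coe_Phi, tau_eq]
    simp only [map_add, map_smul, inner_add_left, inner_add_right, inner_smul_left,
      inner_smul_right, map_neg, neg_smul, inner_neg_left, inner_neg_right]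
    simp
    linear_combination (⟪T (incl b x), incl b x⟫ + ⟪T (b (Fin.last n)), b (Fin.last n)⟫) * h
  rw [sphDiv_tang (contDiff_horField b hX.1 t), hα, fderiv_horField b hX.1, sphDiv, meridDeriv,
    ← hT, trace_eq_trace_hor b T]
  have h5 : ⟪(Real.cos t • (horL b).comp (T.comp (incl b))) (x : Euc n), (x : Euc n)⟫ =
      Real.cos t * ⟪T (incl b x), incl b x⟫ := by
    simp [real_inner_comm _ (T (incl b (x : Euc n))), inner_incl,
      real_inner_comm (x : Euc n), inner_smul_right]
  rw [h5, ContinuousLinearMap.toLinearMap_smul, map_smul, smul_eq_mul]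
  linear_combination Real.cos t * hr

end Divergence

/-! ### Integration against cosᵐ t dt -/

section Slice

theorem ae_mem_slice (m : ℕ) :
    ∀ᵐ t ∂(slice m), t ∈ Set.Ioo (-(Real.pi / 2)) (Real.pi / 2) :=
  (withDensity_absolutelyContinuous _ _).ae_le (ae_restrict_mem measurableSet_Ioo)

theorem ae_prod_mem_slice (m : ℕ) :
    ∀ᵐ p ∂((surf (m + 1)).prod (slice m)), p.2 ∈ Set.Ioo (-(Real.pi / 2)) (Real.pi / 2) :=
  Measure.quasiMeasurePreserving_snd.ae (ae_mem_slice m)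

theorem integral_slice (m : ℕ) (f : ℝ → ℝ) :
    ∫ t, f t ∂(slice m) = ∫ t in (-(Real.pi / 2))..(Real.pi / 2), Real.cos t ^ m * f t := by
  rw [slice, integral_withDensity_eq_integral_toReal_smul (by fun_prop) (by simp),
    intervalIntegral.integral_of_le (by linarith [Real.pi_pos]), integral_Ioc_eq_integral_Ioo]
  refine setIntegral_congr_fun measurableSet_Ioo fun t ht => ?_
  have := Real.cos_pos_of_mem_Ioo ht
  simp only [smul_eq_mul]
  rw [ENNReal.toReal_ofReal (by positivity)]

theorem exists_bound_slice {m : ℕ} {F : Type*} [NormedAddCommGroup F] {c : Sph (m + 1) × ℝ → F}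
    (hc : Continuous c) :
    ∃ C, ∀ᵐ p ∂((surf (m + 1)).prod (slice m)), ‖c p‖ ≤ C := by
  obtain ⟨C, hC⟩ := ((isCompact_univ (X := Sph (m + 1))).prod
    (isCompact_Icc (a := -(Real.pi / 2)) (b := Real.pi / 2))).exists_bound_of_continuousOn
      hc.continuousOn
  exact ⟨C, (ae_prod_mem_slice m).mono fun p hp => hC p ⟨trivial, hp.1.le, hp.2.le⟩⟩

theorem integrable_mul_slice {m : ℕ} {h : Sph (m + 1) → ℝ} (hh : Integrable h (surf (m + 1)))
    {c : Sph (m + 1) × ℝ → ℝ} (hc : Continuous c) :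
    Integrable (fun p => h p.1 * c p) ((surf (m + 1)).prod (slice m)) := by
  obtain ⟨C, hC⟩ := exists_bound_slice hc
  exact (hh.comp_fst (slice m)).mul_bdd (c := C) hc.aestronglyMeasurable hC

theorem integrable_inner_slice {m : ℕ} {G : Sph (m + 1) → Euc (m + 1)}
    (hG : Integrable G (surf (m + 1))) {c : Sph (m + 1) × ℝ → Euc (m + 1)} (hc : Continuous c) :
    Integrable (fun p => ⟪G p.1, c p⟫) ((surf (m + 1)).prod (slice m)) := by
  obtain ⟨C, hC⟩ := exists_bound_slice hc
  have hG' := hG.comp_fst (slice m)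
  refine (hG'.norm.mul_const C).mono' (hG'.aestronglyMeasurable.inner hc.aestronglyMeasurable)
    (hC.mono fun p hp => ?_)
  exact (norm_inner_le_norm _ _).trans (by gcongr)

end Slice

/-! ### Continuity of the integrands -/

section Continuity

theorem continuous_sphDiv {n : ℕ} {X : Euc n → Euc n} (hX : ContDiff ℝ ∞ X) :
    Continuous (sphDiv X) := by
  have h1 : Continuous fun x : Sph n => fderiv ℝ X x :=
    (hX.continuous_fderiv (by simp)).comp continuous_subtype_val
  unfold sphDiv
  refine Continuous.sub ?_ ((h1.clm_apply continuous_subtype_val).inner continuous_subtype_val)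
  simp_rw [LinearMap.trace_eq_sum_inner _ (EuclideanSpace.basisFun (Fin n) ℝ)]
  exact continuous_finsetSum _ fun i _ =>
    continuous_const.inner (h1.clm_apply continuous_const)

variable {n : ℕ} (b : OrthonormalBasis (Fin (n + 1)) ℝ (Euc (n + 1)))

theorem continuous_tau : Continuous fun p : Sph n × ℝ => tau b (p.1 : Euc n) p.2 := by
  unfold tau
  exact (continuous_rot b).comp (f := fun p : Sph n × ℝ =>
    (-Real.sin p.2 • (p.1 : Euc n), Real.cos p.2)) (by fun_prop)

theorem continuous_merid {X : Euc (n + 1) → Euc (n + 1)} (hX : ContDiff ℝ ∞ X) :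
    Continuous fun p : Sph n × ℝ => merid b X p.1 p.2 :=
  (hX.continuous.comp (continuous_subtype_val.comp (continuous_Phi b))).inner (continuous_tau b)

theorem continuous_meridDeriv {X : Euc (n + 1) → Euc (n + 1)} (hX : ContDiff ℝ ∞ X) :
    Continuous fun p : Sph n × ℝ => meridDeriv b X p.1 p.2 :=
  ((((hX.continuous_fderiv (by simp)).comp
    (continuous_subtype_val.comp (continuous_Phi b)))).clm_apply (continuous_tau b)).inner
      (continuous_tau b)

theorem continuous_meridDeriv_right {X : Euc (n + 1) → Euc (n + 1)} (hX : ContDiff ℝ ∞ X)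
    (x : Sph n) : Continuous fun t => meridDeriv b X x t := by
  have h := (continuous_meridDeriv b hX).comp (Continuous.prodMk_right x)
  exact h

theorem continuous_tang_horField {X : Euc (n + 1) → Euc (n + 1)} (hX : ContDiff ℝ ∞ X) :
    Continuous fun p : Sph n × ℝ => tang (horField b X p.2) (p.1 : Euc n) := by
  have h1 : Continuous fun p : Sph n × ℝ => horField b X p.2 (p.1 : Euc n) :=
    (horL b).continuous.comp (hX.continuous.comp
      (continuous_subtype_val.comp (continuous_Phi b)))
  have h2 : Continuous fun p : Sph n × ℝ => (p.1 : Euc n) :=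
    continuous_subtype_val.comp continuous_fst
  have h3 : Continuous fun p : Sph n × ℝ => ⟪horField b X p.2 (p.1 : Euc n), (p.1 : Euc n)⟫ :=
    h1.inner h2
  exact h1.sub (h3.fun_smul h2)

end Continuity

/-- With the weight cosᵐ t the integrand is the derivative of cosᵐ⁺¹ t times the meridian component,
and cosᵐ⁺¹ vanishes at ±π/2: the poles give no boundary term. -/
theorem integral_slice_meridian {m : ℕ}
    (b : OrthonormalBasis (Fin (m + 1 + 1)) ℝ (Euc (m + 1 + 1)))
    {X : Euc (m + 1 + 1) → Euc (m + 1 + 1)} (hX : IsTangentField X) (x : Sph (m + 1)) :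
    ∫ t, (Real.cos t * meridDeriv b X x t - (m + 1) * (Real.sin t * merid b X x t))
      ∂(slice m) = 0 := by
  rw [integral_slice]
  have c1 : Continuous fun t => merid b X x t :=
    continuous_iff_continuousAt.2 fun t => (hasDerivAt_merid b hX x t).continuousAt
  have c2 : Continuous fun t => meridDeriv b X x t := continuous_meridDeriv_right b hX.1 x
  have hd : ∀ t ∈ Set.uIcc (-(Real.pi / 2)) (Real.pi / 2),
      HasDerivAt (fun t => Real.cos t ^ (m + 1) * merid b X x t)
        (Real.cos t ^ m * (Real.cos t * meridDeriv b X x t -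
          (m + 1) * (Real.sin t * merid b X x t))) t := fun t _ => by
    have hp : HasDerivAt (fun t => Real.cos t ^ (m + 1))
        ((m + 1) * Real.cos t ^ m * -Real.sin t) t := by
      simpa using (Real.hasDerivAt_cos t).fun_pow (m + 1)
    refine (hp.fun_mul (hasDerivAt_merid b hX x t)).congr_deriv ?_
    ring
  rw [intervalIntegral.integral_eq_sub_of_hasDerivAt hd
    (Continuous.intervalIntegrable (by fun_prop) _ _)]
  simp

/-! ### The weak gradient of the extension -/

section Lift

variable {m : ℕ} (b : OrthonormalBasis (Fin (m + 1 + 1)) ℝ (Euc (m + 1 + 1)))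

/-- The point of `S^{n-1}` on the meridian of `v`. -/
noncomputable def foot (v : Sph (m + 1 + 1)) : Sph (m + 1) := dir (hor b v)

/-- The gradient of `extend b h` at `v`, where `G` is the gradient of `h`. -/
noncomputable def liftGrad (h : Sph (m + 1) → ℝ) (G : Sph (m + 1) → Euc (m + 1))
    (v : Sph (m + 1 + 1)) : Euc (m + 1 + 1) :=
  incl b (G (foot b v)) - (⟪b (Fin.last (m + 1)), (v : Euc (m + 1 + 1))⟫ * h (foot b v)) •
    (-⟪b (Fin.last (m + 1)), (v : Euc (m + 1 + 1))⟫ • incl b (foot b v) +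
      ‖hor b v‖ • b (Fin.last (m + 1)))

theorem extend_eq (h : Sph (m + 1) → ℝ) (v : Sph (m + 1 + 1)) :
    extend b h v = ‖hor b v‖ * h (foot b v) := by
  by_cases H : hor b (v : Euc (m + 1 + 1)) = 0
  · simp [extend, H]
  · simp [extend, H, foot, dir]

theorem hor_Phi (x : Sph (m + 1)) (t : ℝ) :
    hor b (Phi b x t) = Real.cos t • (x : Euc (m + 1)) := hor_rot b _ _

theorem foot_Phi (x : Sph (m + 1)) {t : ℝ} (ht : t ∈ Set.Ioo (-(Real.pi / 2)) (Real.pi / 2)) :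
    foot b (Phi b x t) = x := by
  rw [foot, hor_Phi, dir_smul (Real.cos_pos_of_mem_Ioo ht)]

/-- The form in which `liftGrad` is used: a component along the parallel and one along the meridian,
with no singular factor 1/cos t. -/
theorem liftGrad_Phi (h : Sph (m + 1) → ℝ) (G : Sph (m + 1) → Euc (m + 1)) (x : Sph (m + 1))
    {t : ℝ} (ht : t ∈ Set.Ioo (-(Real.pi / 2)) (Real.pi / 2)) :
    liftGrad b h G (Phi b x t) =
      incl b (G x) - (Real.sin t * h x) • tau b x t := by
  have hs : ⟪b (Fin.last (m + 1)), (Phi b x t : Euc (m + 1 + 1))⟫ = Real.sin t := by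
    rw [coe_Phi, inner_add_right, inner_smul_right, real_inner_comm, inner_incl, hor_last]
    simp [inner_smul_right]
  have hc : ‖hor b (Phi b x t : Euc (m + 1 + 1))‖ = Real.cos t := by
    rw [hor_Phi, norm_smul, norm_eq_of_mem_sphere, mul_one, Real.norm_eq_abs,
      abs_of_pos (Real.cos_pos_of_mem_Ioo ht)]
  rw [liftGrad, foot_Phi b x ht, hs, hc, tau_eq]

theorem measurable_foot : Measurable (foot b) :=
  measurable_dir.comp ((horL b).continuous.measurable.comp measurable_subtype_coe)

/-- In the coordinates (x, t), `foot` is almost everywhere the first projection. Properties of h and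
G that hold only almost everywhere can therefore be pulled back to Sⁿ. -/
theorem quasiMeasurePreserving_foot :
    Measure.QuasiMeasurePreserving (foot b) (surf (m + 1 + 1)) (surf (m + 1)) := by
  refine ⟨measurable_foot b, ?_⟩
  have hΦ := measurePreserving_Phi b
  rw [← hΦ.map_eq, Measure.map_map (measurable_foot b) hΦ.measurable]
  have e : (foot b ∘ fun p : Sph (m + 1) × ℝ => Phi b p.1 p.2)
      =ᵐ[(surf (m + 1)).prod (slice m)] Prod.fst :=
    (ae_prod_mem_slice m).mono fun p hp => foot_Phi b p.1 hp
  rw [Measure.map_congr e]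
  exact Measure.quasiMeasurePreserving_fst.absolutelyContinuous

theorem aestronglyMeasurable_extend {h : Sph (m + 1) → ℝ}
    (hh : AEStronglyMeasurable h (surf (m + 1))) :
    AEStronglyMeasurable (extend b h) (surf (m + 1 + 1)) := by
  have e : extend b h = fun v : Sph (m + 1 + 1) => ‖hor b v‖ * h (foot b v) :=
    funext fun v => extend_eq b h v
  rw [e]
  have hc : Continuous fun v : Sph (m + 1 + 1) => ‖hor b v‖ :=
    ((horL b).continuous.comp continuous_subtype_val).norm
  exact hc.aestronglyMeasurable.mul
    (hh.comp_quasiMeasurePreserving (quasiMeasurePreserving_foot b))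

theorem aestronglyMeasurable_liftGrad {h : Sph (m + 1) → ℝ} {G : Sph (m + 1) → Euc (m + 1)}
    (hh : AEStronglyMeasurable h (surf (m + 1))) (hG : AEStronglyMeasurable G (surf (m + 1))) :
    AEStronglyMeasurable (liftGrad b h G) (surf (m + 1 + 1)) := by
  have hq := quasiMeasurePreserving_foot b
  have hc : Continuous fun v : Sph (m + 1 + 1) => ‖hor b v‖ :=
    ((horL b).continuous.comp continuous_subtype_val).norm
  have hs : Continuous fun v : Sph (m + 1 + 1) =>
      ⟪b (Fin.last (m + 1)), (v : Euc (m + 1 + 1))⟫ := by fun_prop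
  have hf : AEStronglyMeasurable (fun v : Sph (m + 1 + 1) => incl b (foot b v : Euc (m + 1)))
      (surf (m + 1 + 1)) :=
    ((incl b).continuous.measurable.comp
      (measurable_subtype_coe.comp (measurable_foot b))).aestronglyMeasurable
  exact ((incl b).continuous.comp_aestronglyMeasurable (hG.comp_quasiMeasurePreserving hq)).sub
    ((hs.aestronglyMeasurable.mul (hh.comp_quasiMeasurePreserving hq)).smul
      ((hs.aestronglyMeasurable.neg.smul hf).add
        (hc.aestronglyMeasurable.smul aestronglyMeasurable_const)))

theorem integral_surf_succ {f : Sph (m + 1 + 1) → ℝ}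
    (hf : AEStronglyMeasurable f (surf (m + 1 + 1))) :
    ∫ v, f v ∂(surf (m + 1 + 1)) =
      ∫ p, f (Phi b p.1 p.2) ∂((surf (m + 1)).prod (slice m)) := by
  have hΦ := measurePreserving_Phi b
  conv_lhs => rw [← hΦ.map_eq]
  rw [integral_map hΦ.aemeasurable (by rwa [hΦ.map_eq])]

theorem norm_incl (y : Euc (m + 1)) : ‖incl b y‖ = ‖y‖ := by
  have h := norm_rot_sq b y 0
  rw [zero_pow two_ne_zero, add_zero] at h
  exact (sq_eq_sq₀ (norm_nonneg _) (norm_nonneg _)).1 h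

theorem memLp_extend {h : Sph (m + 1) → ℝ} (hh : MemLp h 2 (surf (m + 1))) :
    MemLp (extend b h) 2 (surf (m + 1 + 1)) := by
  have hΦ := measurePreserving_Phi b
  have hm := aestronglyMeasurable_extend b hh.1
  have hh2 := hh.comp_fst (slice m)
  rw [← hΦ.map_eq] at hm ⊢
  rw [memLp_map_measure_iff hm hΦ.aemeasurable]
  refine hh2.mono (hm.comp_aemeasurable hΦ.aemeasurable) ((ae_prod_mem_slice m).mono fun p hp => ?_)
  simp only [Function.comp_apply, extend_Phi b h p.1 p.2 hp, norm_mul]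
  exact mul_le_of_le_one_left (norm_nonneg _) (by simpa using Real.abs_cos_le_one p.2)

theorem memLp_liftGrad {h : Sph (m + 1) → ℝ} {G : Sph (m + 1) → Euc (m + 1)}
    (hh : MemLp h 2 (surf (m + 1))) (hG : MemLp G 2 (surf (m + 1))) :
    MemLp (liftGrad b h G) 2 (surf (m + 1 + 1)) := by
  have hΦ := measurePreserving_Phi b
  have hm := aestronglyMeasurable_liftGrad b hh.1 hG.1
  -- The dominating function is ‖G‖ + |h|, since `incl` is isometric, `tau` is a unit vector and
  -- |sin t| ≤ 1.
  have hh2 := (hG.norm.add hh.norm).comp_fst (slice m)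
  rw [← hΦ.map_eq] at hm ⊢
  rw [memLp_map_measure_iff hm hΦ.aemeasurable]
  refine hh2.mono (hm.comp_aemeasurable hΦ.aemeasurable) ((ae_prod_mem_slice m).mono fun p hp => ?_)
  simp only [Function.comp_apply, liftGrad_Phi b h G p.1 hp, Pi.add_apply]
  refine (norm_sub_le _ _).trans ?_
  rw [norm_incl, norm_smul, norm_tau, mul_one, norm_mul, Real.norm_of_nonneg (r := ‖G p.1‖ + ‖h p.1‖)
    (by positivity)]
  gcongr
  exact mul_le_of_le_one_left (norm_nonneg _) (by simpa using Real.abs_sin_le_one p.2)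

theorem inner_liftGrad (h : Sph (m + 1) → ℝ) {G : Sph (m + 1) → Euc (m + 1)}
    {v : Sph (m + 1 + 1)} (hv : ⟪G (foot b v), (foot b v : Euc (m + 1))⟫ = 0) :
    ⟪liftGrad b h G v, (v : Euc (m + 1 + 1))⟫ = 0 := by
  have hf : hor b v = ‖hor b v‖ • (foot b v : Euc (m + 1)) := (norm_smul_dir _).symm
  have h1 : ⟪G (foot b v), hor b v⟫ = 0 := by rw [hf, inner_smul_right, hv, mul_zero]
  have h2 : ⟪(foot b v : Euc (m + 1)), hor b v⟫ = ‖hor b v‖ := by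
    conv_lhs => rw [hf]
    simp [inner_smul_right]
  simp only [liftGrad, inner_sub_left, inner_smul_left, inner_add_left, inner_incl, h1, h2,
    conj_trivial]
  ring

theorem inner_liftGrad_Phi {h : Sph (m + 1) → ℝ} {G : Sph (m + 1) → Euc (m + 1)}
    (X : Euc (m + 1 + 1) → Euc (m + 1 + 1)) {x : Sph (m + 1)} (hx : ⟪G x, (x : Euc (m + 1))⟫ = 0)
    {t : ℝ} (ht : t ∈ Set.Ioo (-(Real.pi / 2)) (Real.pi / 2)) :
    ⟪liftGrad b h G (Phi b x t), X (Phi b x t)⟫ =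
      ⟪G x, tang (horField b X t) x⟫ - h x * (Real.sin t * merid b X x t) := by
  rw [liftGrad_Phi b h G x ht, inner_tang _ hx, inner_sub_left, inner_smul_left, inner_incl,
    merid, real_inner_comm (tau b (x : Euc (m + 1)) t)]
  simp only [conj_trivial]
  have h0 : horField b X t x = hor b (X (Phi b x t)) := rfl
  rw [h0]
  ring

theorem isWeakGradient_liftGrad {h : Sph (m + 1) → ℝ} {G : Sph (m + 1) → Euc (m + 1)}
    (hh : MemLp h 2 (surf (m + 1))) (hG : IsWeakGradient h G) :
    IsWeakGradient (extend b h) (liftGrad b h G) := by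
  obtain ⟨hG1, hG2, hG3⟩ := hG
  have hΦ := measurePreserving_Phi b
  have hGp : ∀ᵐ p ∂((surf (m + 1)).prod (slice m)), ⟪G p.1, (p.1 : Euc (m + 1))⟫ = 0 :=
    Measure.quasiMeasurePreserving_fst.ae hG2
  have hmG := aestronglyMeasurable_liftGrad b hh.1 hG1.1
  have hhi := hh.integrable (by norm_num)
  have hGi := hG1.integrable (by norm_num)
  refine ⟨memLp_liftGrad b hh hG1, ?_, fun X hX => ?_⟩
  · refine ((quasiMeasurePreserving_foot b).ae hG2).mono fun v hv => ?_
    exact inner_liftGrad b h hv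
  have cD : Continuous fun p : Sph (m + 1) × ℝ => sphDiv X (Phi b p.1 p.2) :=
    (continuous_sphDiv hX.1).comp (continuous_Phi b)
  have cβ := continuous_merid b hX.1
  have cq := continuous_meridDeriv b hX.1
  have cY := continuous_tang_horField b hX.1
  have cK : Continuous fun p : Sph (m + 1) × ℝ => sphDiv (tang (horField b X p.2)) p.1 := by
    simp_rw [sphDiv_tang_horField b hX]
    fun_prop
  have i1 := integrable_mul_slice hhi cK
  have i2 := integrable_mul_slice hhi (c := fun p => Real.cos p.2 * meridDeriv b X p.1 p.2 -
    (m + 1) * (Real.sin p.2 * merid b X p.1 p.2)) (by fun_prop)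
  have i3 := integrable_mul_slice hhi (c := fun p => Real.sin p.2 * merid b X p.1 p.2)
    (by fun_prop)
  have i4 := integrable_inner_slice hGi cY
  have e1 : ∫ p, h p.1 * sphDiv (tang (horField b X p.2)) p.1
      ∂((surf (m + 1)).prod (slice m)) =
      -∫ p, ⟪G p.1, tang (horField b X p.2) p.1⟫ ∂((surf (m + 1)).prod (slice m)) := by
    -- For fixed t the tangential part of `horField b X t` is a smooth tangent field of the lower
    -- sphere, hence a test field for G; so x is integrated first.
    rw [integral_prod_symm _ i1, integral_prod_symm _ i4, ← integral_neg]
    exact integral_congr_ae (Filter.Eventually.of_forall fun t =>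
      hG3 _ (isTangentField_tang (contDiff_horField b hX.1 t)))
  have e2 : ∫ p, h p.1 * (Real.cos p.2 * meridDeriv b X p.1 p.2 -
      (m + 1) * (Real.sin p.2 * merid b X p.1 p.2)) ∂((surf (m + 1)).prod (slice m)) = 0 := by
    -- Here t is integrated first, because h(x) is constant along each meridian.
    rw [integral_prod _ i2]
    refine integral_eq_zero_of_ae (Filter.Eventually.of_forall fun x => ?_)
    simp only [integral_const_mul, integral_slice_meridian b hX x, mul_zero, Pi.zero_apply]
  rw [integral_surf_succ b (f := fun v => extend b h v * sphDiv X v)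
      ((aestronglyMeasurable_extend b hh.1).mul (continuous_sphDiv hX.1).aestronglyMeasurable),
    integral_surf_succ b (f := fun v => ⟪liftGrad b h G v, X v⟫) (hmG.inner
      (hX.1.continuous.comp continuous_subtype_val).aestronglyMeasurable)]
  -- The coefficient m of sin t β from `sphDiv_tang_horField` is written (m + 1) - 1: the part m + 1
  -- completes the exact derivative, and the remaining one is the meridian part of the pairing with
  -- `liftGrad`.
  calc ∫ p, extend b h (Phi b p.1 p.2) * sphDiv X (Phi b p.1 p.2)
        ∂((surf (m + 1)).prod (slice m))
      = ∫ p, (h p.1 * sphDiv (tang (horField b X p.2)) p.1 +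
          h p.1 * (Real.cos p.2 * meridDeriv b X p.1 p.2 -
            (m + 1) * (Real.sin p.2 * merid b X p.1 p.2)) +
          h p.1 * (Real.sin p.2 * merid b X p.1 p.2)) ∂((surf (m + 1)).prod (slice m)) := by
        refine integral_congr_ae ((ae_prod_mem_slice m).mono fun p hp => ?_)
        simp only [extend_Phi b h p.1 p.2 hp, sphDiv_tang_horField b hX]
        push_cast
        ring
    _ = -∫ p, (⟪G p.1, tang (horField b X p.2) p.1⟫ -
          h p.1 * (Real.sin p.2 * merid b X p.1 p.2)) ∂((surf (m + 1)).prod (slice m)) := by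
        rw [integral_add (i1.fun_add i2) i3, integral_add i1 i2, e1, e2, integral_sub i4 i3]
        ring
    _ = _ := by
        congr 1
        refine integral_congr_ae ?_
        filter_upwards [ae_prod_mem_slice m, hGp] with p hp hGp
        exact (inner_liftGrad_Phi b X hGp hp).symm

end Lift

/-! ### Wallis integrals and volumes of balls -/

/-- The integral of `cosᵏ` over `[-π/2, π/2]`. -/
noncomputable def wallis (k : ℕ) : ℝ :=
  ∫ t in (-(Real.pi / 2))..(Real.pi / 2), Real.cos t ^ k

theorem wallis_add_two (k : ℕ) : (k + 2) * wallis (k + 2) = (k + 1) * wallis k := by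
  rw [wallis, wallis, integral_cos_pow]
  simp
  field_simp

theorem integral_slice_one (m : ℕ) : ∫ _, (1 : ℝ) ∂(slice m) = wallis m := by
  rw [integral_slice, wallis]
  simp only [mul_one]

theorem integral_slice_cos_sq (m : ℕ) :
    ∫ t, Real.cos t ^ 2 ∂(slice m) = wallis (m + 2) := by
  simp only [integral_slice, wallis, pow_add]

theorem integral_slice_sin_sq (m : ℕ) :
    ∫ t, Real.sin t ^ 2 ∂(slice m) = wallis m - wallis (m + 2) := by
  rw [integral_slice, wallis, wallis, ← intervalIntegral.integral_sub
    (Continuous.intervalIntegrable (by fun_prop) _ _)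
    (Continuous.intervalIntegrable (by fun_prop) _ _)]
  refine intervalIntegral.integral_congr fun t _ => ?_
  simp only [Real.sin_sq]
  ring

theorem kappa_zero : kappa 0 = 1 := by
  simp [kappa, volume_euclideanSpace_eq_dirac]

theorem kappa_one : kappa 1 = 2 := by
  have h : Real.Gamma (1 / 2 + 1) = √Real.pi / 2 := by
    rw [Real.Gamma_add_one (by norm_num), Real.Gamma_one_half_eq]
    ring
  have hp : 0 < √Real.pi := Real.sqrt_pos.2 Real.pi_pos
  rw [kappa, EuclideanSpace.volume_closedBall]
  simp only [Fintype.card_fin, ENNReal.ofReal_one, one_mul, pow_one, Nat.cast_one]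
  rw [h, ENNReal.toReal_ofReal (by positivity)]
  field_simp

theorem kappa_pos (m : ℕ) : 0 < kappa m :=
  ENNReal.toReal_pos (Metric.measure_closedBall_pos _ _ one_pos).ne' measure_closedBall_lt_top.ne

theorem surf_real_univ (m : ℕ) : (surf m).real Set.univ = m * kappa m := by
  rw [surf, Measure.toSphere_real_apply_univ, kappa, finrank_euclideanSpace_fin,
    Measure.addHaar_unitClosedBall_eq_addHaar_unitBall]
  rfl

/-- Comparing total masses in `measurePreserving_Phi` gives (j+2) κ_{j+2} = (j+1) κ_{j+1} W_j, and
the Wallis recursion turns (j+1) W_j into (j+2) W_{j+2}. The case k = 0 has no lower sphere and is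
computed directly. -/
theorem kappa_succ (k : ℕ) : kappa (k + 1) = wallis (k + 1) * kappa k := by
  rcases k with - | j
  · rw [zero_add, kappa_one, kappa_zero, wallis]
    simp
    norm_num
  · have hΦ := measurePreserving_Phi (m := j) (EuclideanSpace.basisFun _ ℝ)
    have h1 : (surf (j + 1 + 1)).real Set.univ =
        (surf (j + 1)).real Set.univ * (slice j).real Set.univ := by
      rw [← hΦ.map_eq, map_measureReal_apply hΦ.measurable .univ, Set.preimage_univ,
        ← Set.univ_prod_univ, measureReal_prod_prod]
    have h2 : (slice j).real Set.univ = wallis j := by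
      rw [← integral_slice_one]
      simp
    rw [surf_real_univ, surf_real_univ, h2] at h1
    have h3 := wallis_add_two j
    push_cast at h1
    have hj : (0 : ℝ) < j + 1 + 1 := by positivity
    refine mul_left_cancel₀ hj.ne' ?_
    linear_combination h1 - kappa (j + 1) * h3

/-! ### The L² norms of the extension and of its gradient -/

section Lift

variable {m : ℕ} (b : OrthonormalBasis (Fin (m + 1 + 1)) ℝ (Euc (m + 1 + 1)))

theorem integral_extend_sq {h : Sph (m + 1) → ℝ} (hh : MemLp h 2 (surf (m + 1))) :
    ∫ v, extend b h v ^ 2 ∂(surf (m + 1 + 1)) =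
      wallis (m + 2) * ∫ x, h x ^ 2 ∂(surf (m + 1)) := by
  rw [integral_surf_succ b (f := fun v => extend b h v ^ 2)
    ((aestronglyMeasurable_extend b hh.1).pow 2), ← integral_slice_cos_sq, mul_comm,
    ← integral_prod_mul]
  refine integral_congr_ae ((ae_prod_mem_slice m).mono fun p hp => ?_)
  simp only [extend_Phi b h p.1 p.2 hp]
  ring

theorem integral_norm_liftGrad_sq {h : Sph (m + 1) → ℝ} {G : Sph (m + 1) → Euc (m + 1)}
    (hh : MemLp h 2 (surf (m + 1))) (hG : IsWeakGradient h G) :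
    ∫ v, ‖liftGrad b h G v‖ ^ 2 ∂(surf (m + 1 + 1)) =
      wallis m * ∫ x, ‖G x‖ ^ 2 ∂(surf (m + 1)) +
        (wallis m - wallis (m + 2)) * ∫ x, h x ^ 2 ∂(surf (m + 1)) := by
  have hGp : ∀ᵐ p ∂((surf (m + 1)).prod (slice m)), ⟪G p.1, (p.1 : Euc (m + 1))⟫ = 0 :=
    Measure.quasiMeasurePreserving_fst.ae hG.2.1
  have i1 := hG.1.norm.integrable_sq.mul_prod (integrable_const (μ := slice m) (1 : ℝ))
  have i2 := integrable_mul_slice hh.integrable_sq (c := fun p => Real.sin p.2 ^ 2) (by fun_prop)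
  rw [integral_surf_succ b (f := fun v => ‖liftGrad b h G v‖ ^ 2)
    ((aestronglyMeasurable_liftGrad b hh.1 hG.1.1).norm.pow 2), ← integral_slice_sin_sq,
    mul_comm (∫ t, Real.sin t ^ 2 ∂(slice m)), mul_comm (wallis m), ← integral_slice_one,
    ← integral_prod_mul, ← integral_prod_mul, ← integral_add i1 i2]
  refine integral_congr_ae ?_
  filter_upwards [ae_prod_mem_slice m, hGp] with p hp hGp
  -- The horizontal part of `tau` is a multiple of x, to which G x is orthogonal; the two components
  -- of the gradient then obey Pythagoras.
  have h0 : ⟪incl b (G p.1), tau b (p.1 : Euc (m + 1)) p.2⟫ = 0 := by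
    rw [inner_incl, tau, hor_rot, inner_smul_right, hGp, mul_zero]
  simp only [liftGrad_Phi b h G p.1 hp]
  rw [norm_sub_sq_real, inner_smul_right, h0, norm_incl, norm_smul, norm_tau, mul_one,
    Real.norm_eq_abs, sq_abs]
  ring

end Lift

end IntrinsicArea

/-! ### Comparison of the constants -/

open IntrinsicArea in
theorem mainTheorem7 (n : ℕ) (hn : 2 ≤ n)
    (b : OrthonormalBasis (Fin (n + 1)) ℝ (EuclideanSpace ℝ (Fin (n + 1))))
    (hb : IntrinsicArea.IsDirect b)
    (h : IntrinsicArea.Sph n → ℝ) (hh : IntrinsicArea.MemH1 h) :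
    IntrinsicArea.MemH1 (IntrinsicArea.extend b h) ∧
      IntrinsicArea.V2bar (n + 1) (IntrinsicArea.extend b h) = IntrinsicArea.V2bar n h := by
  -- With n = k + 2 the truncated subtractions in `cConst` become κ_k and κ_{k+1}, and the lemmas on
  -- the lift apply with m = k + 1.
  obtain ⟨k, rfl⟩ : ∃ k, n = k + 1 + 1 := ⟨n - 2, by omega⟩
  obtain ⟨h2, G, hG⟩ := hh
  have hL := isWeakGradient_liftGrad b h2 hG
  refine ⟨⟨memLp_extend b h2, _, hL⟩, ?_⟩
  rw [V2bar, V2bar, integral_norm_weakGrad_sq hL, integral_norm_weakGrad_sq hG,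
    integral_norm_liftGrad_sq b h2 hG, integral_extend_sq b h2, cConst, cConst]
  have e1 : k + 1 + 1 + 1 - 2 = k + 1 := rfl
  have e2 : k + 1 + 1 - 2 = k := rfl
  rw [e1, e2]
  have hw := wallis_add_two (k + 1)
  have hk := kappa_succ k
  have hk0 := kappa_pos k
  have hk1 := kappa_pos (k + 1)
  set A := ∫ x, h x ^ 2 ∂(surf (k + 1 + 1))
  set B := ∫ x, ‖G x‖ ^ 2 ∂(surf (k + 1 + 1))
  -- Both Wallis integrals are expressed through κ_{k+1}/κ_k, which leaves a rational identity in k,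
  -- A, B and the two volumes.
  have hw1 : wallis (k + 1) = kappa (k + 1) / kappa k := by
    rw [hk, mul_div_assoc, div_self hk0.ne', mul_one]
  have hk3 : (0 : ℝ) < k + 1 + 2 := by positivity
  have hw3 : wallis (k + 1 + 2) = (k + 2) / (k + 1 + 2) * (kappa (k + 1) / kappa k) := by
    rw [← hw1]
    push_cast at hw
    field_simp
    linear_combination hw
  rw [hw3, hw1]
  push_cast
  have h1 : (k : ℝ) + 1 + 1 + 1 - 1 = k + 2 := by ring
  have h1' : (k : ℝ) + 1 + 1 - 1 = k + 1 := by ring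
  rw [h1, h1']
  field_simp
  ring
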